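/- **Setting.** Let $\mathcal X\subseteq\mathbb R^q$, $\mathcal Y\subseteq\mathbb R$ and $\Theta\subseteq\mathbb R^d$. For $\theta\in\Theta$ and $x\in\mathcal X$ let $P_{Z\mid\theta,X=x}$ be a probability distribution on $\mathbb R$ without atoms, depending measurably on $x$, and let $g:\mathcal Y\to\mathbb R$ be a fixed monotone increasing (i.e. nondecreasing) function. Let $P_{Y\mid g,\theta,X=x}$ be the law on $\mathcal Y$ induced by the transformed regression model $g(y)=z$, $z\sim P_{Z\mid\theta,X=x}$, i.e. the probability law (depending measurably on $x$) whose image under $g$ is $P_{Z\mid\theta,X=x}$; it is assumed to exist (it is then unique). Let $p(y\mid g,\theta,x)\in[0,\infty)$, jointly measurable in $(\theta,x,y)$, be a density of this law with respect to some $\sigma$-finite measure on $\mathcal Y$ not depending on $(\theta,x)$. Let $P_0$ be an arbitrary probability measure on $\mathcal X\times\mathcal Y$ (the true data-generating process, not assumed to belong to the model), let $(x_1,y_1),(x_2,y_2),\dots$ be i.i.d. with law $P_0$, and write $\mathcal D_n=\{(x_i,y_i)\}_{i=1}^n$. Let $P_{g,\theta}$ be the law of $(X,Y)$ for which $X$ has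 the $P_0$-marginal law and $Y\mid X=x$ has law $P_{Y\mid g,\theta,X=x}$. Let $\Pi_\theta$ be a prior probability measure on $\Theta$, and let $$p(\theta\in A\mid\mathcal D_n,g)=\frac{\int_A\prod_{i=1}^n p(y_i\mid g,\theta,x_i)\,\Pi_\theta(d\theta)}{\int_\Theta\prod_{i=1}^n p(y_i\mid g,\theta,x_i)\,\Pi_\theta(d\theta)}$$ be the conditional posterior. **Theorem.** Assume that 1. there is a $\theta^*(g)\in\operatorname{int}(\Theta)$ which is the unique minimizer of $\theta\mapsto \mathrm{KL}(P_0,P_{g,\theta})\in[0,\infty]$ over $\Theta$; 2. for every $\theta\in\Theta$, $\mathbb E_{P_0}\log p(Y\mid g,\theta,X)$ exists and is finite; 3. for $P_0$-almost every $(X,Y)$, the map $\theta\mapsto\log p(Y\mid g,\theta,X)\in[-\infty,\infty)$ is concave on $\Theta$ (in particular $\Theta$ is convex); 4. $\Pi_\theta(\mathcal U)>0$ for every open (in $\Theta$) neighbourhood $\mathcal U$ of $\theta^*(g)$. Then $p(\theta\mid\mathcal D_n,g)$ is strongly consistent at $\theta^*(g)$ in the Euclidean topology: almost surely, $p(\theta\in\mathcal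 U\mid\mathcal D_n,g)\to1$ as $n\to\infty$ for every neighbourhood $\mathcal U$ of $\theta^*(g)$ in $\Theta$. -/

import Mathlib

open MeasureTheory ProbabilityTheory Filter Topology
open scoped ENNReal NNReal

/-- The response law `Q` (the conditional law of `y ∈ 𝒴` given `x`) is the one induced by the
transformed regression model `g y = z`, `z ∼ PZ x`: if `y ∼ Q x`, then `g y ∼ PZ x`. -/
def InducedBy {𝒳 : Type*} [MeasurableSpace 𝒳] {𝒴 : Set ℝ} (g : 𝒴 → ℝ)
    (PZ : Kernel 𝒳 ℝ) (Q : Kernel 𝒳 𝒴) : Prop :=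
  ∀ x, (Q x).map g = PZ x

/-- A monotone function on a set of reals is Borel measurable. -/
theorem measurable_of_monotone_subtype {𝒴 : Set ℝ} {g : 𝒴 → ℝ} (hg : Monotone g) :
    Measurable g := by
  refine measurable_of_Iic fun c => ?_
  have hS : (lowerClosure (Subtype.val '' (g ⁻¹' Set.Iic c)) : Set ℝ).OrdConnected :=
    (lowerClosure _).lower.ordConnected
  have h : g ⁻¹' Set.Iic c =
      Subtype.val ⁻¹' (lowerClosure (Subtype.val '' (g ⁻¹' Set.Iic c)) : Set ℝ) := by
    ext y
    constructor
    · intro hy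
      exact subset_lowerClosure ⟨y, hy, rfl⟩
    · rintro ⟨_, ⟨b, hb, rfl⟩, hyb⟩
      exact (hg (show y ≤ b from hyb)).trans hb
  rw [h]
  exact measurable_subtype_coe hS.measurableSet

/-- For monotone `g` and a latent model with continuous distributions, there is at most one
response law induced by the model, so that `InducedBy` determines it. -/
theorem InducedBy.unique {𝒳 : Type*} [MeasurableSpace 𝒳] {𝒴 : Set ℝ} {g : 𝒴 → ℝ}
    (hg : Monotone g) {PZ : Kernel 𝒳 ℝ} (hPZ : ∀ x z, PZ x {z} = 0)
    {Q Q' : Kernel 𝒳 𝒴} [IsMarkovKernel Q] [IsMarkovKernel Q']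
    (h : InducedBy g PZ Q) (h' : InducedBy g PZ Q') : Q = Q' := by
  have hgm := measurable_of_monotone_subtype hg
  have key : ∀ (R : Kernel 𝒳 𝒴), InducedBy g PZ R → ∀ x (s : ℝ),
      R x (Subtype.val ⁻¹' Set.Iic s) =
        PZ x (lowerClosure (g '' (Subtype.val ⁻¹' Set.Iic s)) : Set ℝ) := by
    intro R hR x s
    have hL : MeasurableSet (lowerClosure (g '' (Subtype.val ⁻¹' Set.Iic s)) : Set ℝ) :=
      ((lowerClosure _).lower.ordConnected).measurableSet
    have hpt : ∀ c, R x (g ⁻¹' {c}) = 0 := fun c => by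
      rw [← Measure.map_apply hgm (measurableSet_singleton c), hR x, hPZ]
    rw [← hR x, Measure.map_apply hgm hL]
    apply le_antisymm
    · exact measure_mono fun y hy => subset_lowerClosure ⟨y, hy, rfl⟩
    · have hnull : R x (g ⁻¹' (lowerClosure (g '' (Subtype.val ⁻¹' Set.Iic s)) : Set ℝ) \
          (Subtype.val ⁻¹' Set.Iic s)) = 0 := by
        rcases Set.eq_empty_or_nonempty
          (g ⁻¹' (lowerClosure (g '' (Subtype.val ⁻¹' Set.Iic s)) : Set ℝ) \
            (Subtype.val ⁻¹' Set.Iic s)) with he | ⟨y₀, hy₀⟩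
        · rw [he, measure_empty]
        · refine measure_mono_null (fun y hy => ?_) (hpt (g y₀))
          have aux : ∀ u v : 𝒴,
              u ∈ g ⁻¹' (lowerClosure (g '' (Subtype.val ⁻¹' Set.Iic s)) : Set ℝ) →
              v ∉ Subtype.val ⁻¹' Set.Iic s → g u ≤ g v := by
            rintro u v ⟨_, ⟨a, ha, rfl⟩, hua⟩ hv
            refine hua.trans (hg ?_)
            have h1 : (a : ℝ) ≤ s := ha
            have h2 : s < (v : ℝ) := not_le.mp hv
            exact (h1.trans h2.le : (a : ℝ) ≤ v)
          exact le_antisymm (aux y y₀ hy.1 hy₀.2) (aux y₀ y hy₀.1 hy.2)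
      rw [← measure_sdiff_add_inter _
        (measurable_subtype_coe (measurableSet_Iic (a := s)) :
          MeasurableSet (Subtype.val ⁻¹' Set.Iic s : Set 𝒴)), hnull, zero_add]
      exact measure_mono Set.inter_subset_right
  ext x : 1
  have hmap : (Q x).map Subtype.val = (Q' x).map Subtype.val := by
    refine Measure.ext_of_Iic _ _ fun s => ?_
    rw [Measure.map_apply measurable_subtype_coe measurableSet_Iic,
      Measure.map_apply measurable_subtype_coe measurableSet_Iic, key Q h, key Q' h']
  ext A hA
  obtain ⟨B, hB, rfl⟩ := hA
  rw [← Measure.map_apply measurable_subtype_coe hB, hmap,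
    Measure.map_apply measurable_subtype_coe hB]

/-- `p x y` is a conditional density, with respect to the reference measure `ν`, of the
conditional law `Q` of `y` given `x`. -/
def IsCondDensity {𝒳 𝒴 : Type*} [MeasurableSpace 𝒳] [MeasurableSpace 𝒴]
    (ν : Measure 𝒴) (Q : Kernel 𝒳 𝒴) (p : 𝒳 → 𝒴 → ℝ≥0) : Prop :=
  ∀ x, Q x = ν.withDensity fun y => (p x y : ℝ≥0∞)

/-- `𝔼_P log f` is defined and finite. Since `Real.log 0 = 0` in Mathlib whereas `log 0 = -∞`,
the positivity of `f` almost surely is listed separately. -/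
def FiniteExpectedLog {α : Type*} [MeasurableSpace α] (P : Measure α) (f : α → ℝ≥0) : Prop :=
  (∀ᵐ a ∂P, 0 < f a) ∧ Integrable (fun a => Real.log (f a)) P

/-- `θ ↦ log (f θ) ∈ [-∞, ∞)` is a concave function on the (convex) set `Θ`. -/
def ConcaveLog {E : Type*} [AddCommGroup E] [Module ℝ E] (Θ : Set E) (f : Θ → ℝ≥0) : Prop :=
  Convex ℝ Θ ∧ ∀ (θ₁ θ₂ θ : Θ) (a b : ℝ), 0 ≤ a → 0 ≤ b → a + b = 1 →
    (θ : E) = a • (θ₁ : E) + b • (θ₂ : E) →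
    (a : EReal) * ENNReal.log (f θ₁) + (b : EReal) * ENNReal.log (f θ₂) ≤ ENNReal.log (f θ)

/-- The likelihood of `θ` based on the first `n` observations `(x i, y i)`. -/
noncomputable def likelihood {T 𝒳 𝒴 : Type*} (p : T → 𝒳 → 𝒴 → ℝ≥0)
    (x : ℕ → 𝒳) (y : ℕ → 𝒴) (n : ℕ) (θ : T) : ℝ≥0∞ :=
  ∏ i ∈ Finset.range n, (p θ (x i) (y i) : ℝ≥0∞)

/-- The posterior by Bayes' formula: `A ↦ (∫_A L dπ) / (∫ L dπ)` for the prior `π` and the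
likelihood `L`. -/
noncomputable def bayesPosterior {T : Type*} [MeasurableSpace T] (prior : Measure T)
    (L : T → ℝ≥0∞) : Measure T :=
  (∫⁻ θ, L θ ∂prior)⁻¹ • prior.withDensity L

/-- A sequence of random measures on the parameter space is strongly consistent at `θ₀`: almost
surely, the mass of every neighbourhood of `θ₀` tends to one. -/
def StronglyConsistentAt {Ω T : Type*} [MeasurableSpace Ω] [MeasurableSpace T]
    [TopologicalSpace T] (μ : Measure Ω) (post : ℕ → Ω → Measure T) (θ₀ : T) : Prop :=
  ∀ᵐ ω ∂μ, ∀ U ∈ 𝓝 θ₀, Tendsto (fun n => post n ω U) atTop (𝓝 1)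

/-! Put `ℓ θ = 𝔼 log p(Y | θ, X)`. For each fixed `θ` the strong law makes the likelihood `exp (n (ℓ
θ + o(1)))` almost surely, but the null set depends on `θ`. Log-concavity removes this dependence.
Superlevel sets are convex, so lower bounds at finitely many points hold on their hull
(`exists_ball_expRate_lt`); reflection in the centre of a ball turns these into upper bounds
(`exists_ball_le_expRate`); compactness covers a sphere around `θs`, and convexity along rays
extends the bound to everything outside, even for unbounded `Θ` (`exists_le_expRate_compl_ball`).

The KL divergence is a constant minus `ℓ`, so `θs` is the strict maximizer of `ℓ`
(`integral_log_lt_of_klDiv_lt`). Outside a ball the posterior numerator is then at most `exp (n c)`,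
while the evidence is at least `exp (n c')` times a positive prior mass, with `c < c'`. -/

/-- `f` is log-concave on `Θ`, in the multiplicative form which allows for the value `0`. -/
def LogConcaveOn {E : Type*} [AddCommGroup E] [Module ℝ E] (Θ : Set E) (f : Θ → ℝ≥0∞) : Prop :=
  ∀ (θ₁ θ₂ θ : Θ) (a b : ℝ), 0 ≤ a → 0 ≤ b → a + b = 1 →
    (θ : E) = a • (θ₁ : E) + b • (θ₂ : E) → f θ₁ ^ a * f θ₂ ^ b ≤ f θ

/-! ### Exponential rates and log-concavity -/

/-- The exponential `exp (n * c)` as an extended nonnegative real. -/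
noncomputable def expRate (n : ℕ) (c : ℝ) : ℝ≥0∞ := ENNReal.ofReal (Real.exp (n * c))

theorem expRate_pos (n : ℕ) (c : ℝ) : 0 < expRate n c :=
  ENNReal.ofReal_pos.2 (Real.exp_pos _)

theorem expRate_ne_top (n : ℕ) (c : ℝ) : expRate n c ≠ ∞ := ENNReal.ofReal_ne_top

theorem expRate_mono (n : ℕ) {c c' : ℝ} (h : c ≤ c') : expRate n c ≤ expRate n c' := by
  unfold expRate; gcongr

theorem expRate_rpow (n : ℕ) (c a : ℝ) : expRate n c ^ a = expRate n (a * c) := by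
  unfold expRate
  rw [ENNReal.ofReal_rpow_of_pos (Real.exp_pos _), ← Real.exp_mul]
  congr 2; ring

theorem expRate_mul (n : ℕ) (c c' : ℝ) : expRate n c * expRate n c' = expRate n (c + c') := by
  unfold expRate
  rw [← ENNReal.ofReal_mul (Real.exp_pos _).le, ← Real.exp_add]
  congr 2; ring

theorem tendsto_expRate_zero {c : ℝ} (hc : c < 0) :
    Tendsto (fun n : ℕ => expRate n c) atTop (𝓝 0) := by
  unfold expRate
  rw [← ENNReal.ofReal_zero]
  refine ENNReal.tendsto_ofReal (Real.tendsto_exp_atBot.comp ?_)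
  exact tendsto_natCast_atTop_atTop.atTop_mul_const_of_neg hc

/-- The conventions agree at the value `0` with weight `0`: `0 * ⊥ = 0` in `EReal` matches `0 ^ 0 =
1`. -/
theorem ConcaveLog.logConcaveOn {E : Type*} [AddCommGroup E] [Module ℝ E] {Θ : Set E}
    {f : Θ → ℝ≥0} (hf : ConcaveLog Θ f) : LogConcaveOn Θ fun θ => (f θ : ℝ≥0∞) := by
  intro θ₁ θ₂ θ a b ha hb hab h
  rw [← ENNReal.log_le_log_iff, ENNReal.log_mul_add, ENNReal.log_rpow, ENNReal.log_rpow]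
  exact hf.2 θ₁ θ₂ θ a b ha hb hab h

theorem LogConcaveOn.prod {E ι : Type*} [AddCommGroup E] [Module ℝ E] {Θ : Set E}
    {f : ι → Θ → ℝ≥0∞} (s : Finset ι) (hf : ∀ i ∈ s, LogConcaveOn Θ (f i)) :
    LogConcaveOn Θ fun θ => ∏ i ∈ s, f i θ := by
  intro θ₁ θ₂ θ a b ha hb hab h
  rw [← ENNReal.prod_rpow_of_nonneg ha, ← ENNReal.prod_rpow_of_nonneg hb,
    ← Finset.prod_mul_distrib]
  exact Finset.prod_le_prod' fun i hi => hf i hi θ₁ θ₂ θ a b ha hb hab h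

/-- Strict superlevel sets of a log-concave function are convex. -/
theorem LogConcaveOn.convex_lt {E : Type*} [AddCommGroup E] [Module ℝ E] {Θ : Set E}
    {f : Θ → ℝ≥0∞} (hf : LogConcaveOn Θ f) (hΘ : Convex ℝ Θ) (m : ℝ≥0∞) :
    Convex ℝ {x | ∃ h : x ∈ Θ, m < f ⟨x, h⟩} := by
  rintro x ⟨hx, hxm⟩ y ⟨hy, hym⟩ a b ha hb hab
  refine ⟨hΘ hx hy ha hb hab, ?_⟩
  calc m < min (f ⟨x, hx⟩) (f ⟨y, hy⟩) := lt_min hxm hym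
    _ = min (f ⟨x, hx⟩) (f ⟨y, hy⟩) ^ a * min (f ⟨x, hx⟩) (f ⟨y, hy⟩) ^ b := by
      rw [← ENNReal.rpow_add_of_nonneg _ _ ha hb, hab, ENNReal.rpow_one]
    _ ≤ f ⟨x, hx⟩ ^ a * f ⟨y, hy⟩ ^ b := by
      gcongr
      · exact min_le_left _ _
      · exact min_le_right _ _
    _ ≤ _ := hf ⟨x, hx⟩ ⟨y, hy⟩ _ a b ha hb hab rfl

/-- A log-concave function which is small at a midpoint and not small at one end is small at the
other end. -/
theorem LogConcaveOn.le_of_midpoint {E : Type*} [AddCommGroup E] [Module ℝ E] {Θ : Set E}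
    {f : Θ → ℝ≥0∞} (hf : LogConcaveOn Θ f) {θ w s : Θ} {n : ℕ} {c δ : ℝ}
    (h : (s : E) = (2⁻¹ : ℝ) • (θ : E) + (2⁻¹ : ℝ) • (w : E))
    (hs : f s < expRate n (c + δ)) (hw : expRate n (c - δ) < f w) :
    f θ ≤ expRate n (c + 3 * δ) := by
  by_contra! hθ
  refine (hs.trans_le ?_).false
  -- The factor `3` makes `c + δ` the average of `c + 3 * δ` and `c - δ`.
  calc expRate n (c + δ)
      = expRate n (c + 3 * δ) ^ (2⁻¹ : ℝ) * expRate n (c - δ) ^ (2⁻¹ : ℝ) := by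
        rw [expRate_rpow, expRate_rpow, expRate_mul]; congr 1; ring
    _ ≤ f θ ^ (2⁻¹ : ℝ) * f w ^ (2⁻¹ : ℝ) := by gcongr
    _ ≤ f s := hf θ w s _ _ (by norm_num) (by norm_num) (by norm_num) h

/-! ### From pointwise to uniform exponential bounds -/

section Uniform

variable {E : Type*} [NormedAddCommGroup E] [NormedSpace ℝ E] {Θ : Set E}
  {Ω : Type*} [MeasurableSpace Ω] {μ : Measure Ω} {L : ℕ → Ω → Θ → ℝ≥0∞} {ℓ : E → ℝ}

/-- Pointwise exponential lower bounds for log-concave functions are locally uniform. -/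
theorem exists_ball_expRate_lt [FiniteDimensional ℝ E] (hΘ : Convex ℝ Θ)
    (hL : ∀ᵐ ω ∂μ, ∀ n, LogConcaveOn Θ (L n ω)) (hℓ : ContinuousOn ℓ (interior Θ))
    (hlow : ∀ (θ : Θ) (c : ℝ), c < ℓ θ → ∀ᵐ ω ∂μ, ∀ᶠ n in atTop, expRate n c < L n ω θ)
    {x : E} (hx : x ∈ interior Θ) {c : ℝ} (hc : c < ℓ x) :
    ∃ r > 0, Metric.ball x r ⊆ Θ ∧ ∀ᵐ ω ∂μ, ∀ᶠ n in atTop, ∀ θ : Θ,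
      (θ : E) ∈ Metric.ball x r → expRate n c < L n ω θ := by
  have hnhds : {y | c < ℓ y} ∩ interior Θ ∈ 𝓝 x :=
    inter_mem (((hℓ.continuousAt (isOpen_interior.mem_nhds hx)).eventually_const_lt hc))
      (isOpen_interior.mem_nhds hx)
  -- A simplex around `x` has finitely many vertices, so finitely many null sets suffice to control
  -- a whole ball.
  obtain ⟨b, hb, hbs⟩ := exists_mem_interior_convexHull_affineBasis hnhds
  obtain ⟨r, hr, hball⟩ := Metric.mem_nhds_iff.1 (mem_interior_iff_mem_nhds.1 hb)
  refine ⟨r, hr, fun y hy => interior_subset (hbs (hball hy)).2, ?_⟩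
  have hbΘ : ∀ i, b i ∈ Θ := fun i =>
    interior_subset (hbs (subset_convexHull ℝ _ (Set.mem_range_self i))).2
  have hbc : ∀ i, c < ℓ (b i) := fun i =>
    (hbs (subset_convexHull ℝ _ (Set.mem_range_self i))).1
  filter_upwards [hL, ae_all_iff.2 fun i => hlow ⟨b i, hbΘ i⟩ c (hbc i)] with ω h1 h2
  filter_upwards [eventually_all.2 h2] with n hn θ hθ
  have hsub : convexHull ℝ (Set.range b) ⊆ {x | ∃ h : x ∈ Θ, expRate n c < L n ω ⟨x, h⟩} :=
    convexHull_min (by rintro _ ⟨i, rfl⟩; exact ⟨hbΘ i, hn i⟩) ((h1 n).convex_lt hΘ _)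
  exact (hsub (hball hθ)).2

/-- Pointwise exponential upper bounds for log-concave functions are locally uniform. -/
theorem exists_ball_le_expRate [FiniteDimensional ℝ E] (hΘ : Convex ℝ Θ)
    (hL : ∀ᵐ ω ∂μ, ∀ n, LogConcaveOn Θ (L n ω)) (hℓ : ContinuousOn ℓ (interior Θ))
    (hlow : ∀ (θ : Θ) (c : ℝ), c < ℓ θ → ∀ᵐ ω ∂μ, ∀ᶠ n in atTop, expRate n c < L n ω θ)
    (hupp : ∀ (θ : Θ) (c : ℝ), ℓ θ < c → ∀ᵐ ω ∂μ, ∀ᶠ n in atTop, L n ω θ < expRate n c)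
    {x : E} (hx : x ∈ interior Θ) {c : ℝ} (hc : ℓ x < c) :
    ∃ r > 0, ∀ᵐ ω ∂μ, ∀ᶠ n in atTop, ∀ θ : Θ,
      (θ : E) ∈ Metric.ball x r → L n ω θ ≤ expRate n c := by
  set δ := (c - ℓ x) / 3 with hδ
  have hδ0 : 0 < δ := by rw [hδ]; linarith
  obtain ⟨r, hr, hrΘ, hlo⟩ := exists_ball_expRate_lt hΘ hL hℓ hlow hx
    (show ℓ x - δ < ℓ x by linarith)
  refine ⟨r, hr, ?_⟩
  filter_upwards [hL, hlo, hupp ⟨x, interior_subset hx⟩ (ℓ x + δ)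
    (show ℓ x < ℓ x + δ by linarith)] with ω h1 h2 h3
  filter_upwards [h2, h3] with n h2 h3 θ hθ
  -- The reflection of `θ` in `x` stays in the ball, where the lower bound holds, and `x` is the
  -- midpoint.
  have hw : x + (x - θ) ∈ Metric.ball x r := by
    rw [mem_ball_iff_norm] at hθ ⊢
    rwa [add_sub_cancel_left, norm_sub_rev]
  have hc' : c = ℓ x + 3 * δ := by rw [hδ]; ring
  rw [hc']
  refine (h1 n).le_of_midpoint (w := ⟨_, hrΘ hw⟩) ?_ h3 (h2 ⟨_, hrΘ hw⟩ hw)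
  simp only
  module

/-- If `x` is a strict maximizer of the rate `ℓ`, log-concave functions with exponential rate `ℓ`
are exponentially smaller than `ℓ x` outside small balls around `x`. -/
theorem exists_le_expRate_compl_ball [FiniteDimensional ℝ E] (hΘ : Convex ℝ Θ)
    (hL : ∀ᵐ ω ∂μ, ∀ n, LogConcaveOn Θ (L n ω)) (hℓ : ContinuousOn ℓ (interior Θ))
    (hlow : ∀ (θ : Θ) (c : ℝ), c < ℓ θ → ∀ᵐ ω ∂μ, ∀ᶠ n in atTop, expRate n c < L n ω θ)
    (hupp : ∀ (θ : Θ) (c : ℝ), ℓ θ < c → ∀ᵐ ω ∂μ, ∀ᶠ n in atTop, L n ω θ < expRate n c)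
    {x : E} {ε : ℝ} (hε : 0 < ε) (hx : Metric.closedBall x ε ⊆ interior Θ)
    (hmax : ∀ θ ∈ Θ, θ ≠ x → ℓ θ < ℓ x) :
    ∃ c < ℓ x, ∀ᵐ ω ∂μ, ∀ᶠ n in atTop, ∀ θ : Θ,
      (θ : E) ∉ Metric.ball x ε → L n ω θ ≤ expRate n c := by
  have hxi : x ∈ interior Θ := hx (Metric.mem_closedBall_self hε.le)
  have hsph : ∃ c < ℓ x, ∀ᵐ ω ∂μ, ∀ᶠ n in atTop, ∀ θ : Θ,
      (θ : E) ∈ Metric.sphere x ε → L n ω θ ≤ expRate n c := by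
    -- The property passes to finite unions because the larger of two constants below `ℓ x` is still
    -- below `ℓ x`.
    refine (isCompact_sphere x ε).induction_on
      (p := fun S => ∃ c < ℓ x, ∀ᵐ ω ∂μ, ∀ᶠ n in atTop, ∀ θ : Θ,
        (θ : E) ∈ S → L n ω θ ≤ expRate n c) ?_ ?_ ?_ ?_
    · exact ⟨ℓ x - 1, by linarith, by simp⟩
    · rintro S T hST ⟨c, hc, h⟩
      refine ⟨c, hc, h.mono fun ω h => h.mono fun n h θ hθ => h θ (hST hθ)⟩
    · rintro S T ⟨c, hc, h⟩ ⟨c', hc', h'⟩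
      refine ⟨max c c', max_lt hc hc', ?_⟩
      filter_upwards [h, h'] with ω h h'
      filter_upwards [h, h'] with n h h' θ hθ
      rcases hθ with hθ | hθ
      · exact (h θ hθ).trans (expRate_mono n (le_max_left _ _))
      · exact (h' θ hθ).trans (expRate_mono n (le_max_right _ _))
    · intro s hs
      have hsi : s ∈ interior Θ := hx (Metric.sphere_subset_closedBall hs)
      have hlt : ℓ s < ℓ x := hmax s (interior_subset hsi) (Metric.ne_of_mem_sphere hs hε.ne')
      obtain ⟨c, hc1, hc2⟩ := exists_between hlt
      obtain ⟨r, hr, h⟩ := exists_ball_le_expRate hΘ hL hℓ hlow hupp hsi hc1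
      exact ⟨_, mem_nhdsWithin_of_mem_nhds (Metric.ball_mem_nhds s hr), c, hc2, h⟩
  obtain ⟨c, hc, h⟩ := hsph
  refine ⟨c, hc, ?_⟩
  filter_upwards [hL, h, hlow ⟨x, interior_subset hxi⟩ c hc] with ω h1 h2 h3
  filter_upwards [h2, h3] with n h2 h3 θ hθ
  -- If the value at `θ` exceeded `expRate n c`, as it does at `x`, it would do so on the whole
  -- segment, including the point, at parameter `t`, where the segment crosses the sphere.
  by_contra! hcon
  have hd : ε ≤ ‖(θ : E) - x‖ := by
    rw [mem_ball_iff_norm] at hθ; exact not_lt.1 hθ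
  have hd0 : 0 < ‖(θ : E) - x‖ := hε.trans_le hd
  set t := ε / ‖(θ : E) - x‖ with ht
  have ht0 : 0 ≤ t := by positivity
  have ht1 : t ≤ 1 := (div_le_one hd0).2 hd
  obtain ⟨hy, hyc⟩ := (h1 n).convex_lt hΘ (expRate n c) ⟨interior_subset hxi, h3⟩
    ⟨θ.2, hcon⟩ (sub_nonneg.2 ht1) ht0 (sub_add_cancel 1 t)
  refine (hyc.trans_le (h2 ⟨_, hy⟩ ?_)).false
  rw [mem_sphere_iff_norm]
  have : (1 - t) • x + t • (θ : E) - x = t • ((θ : E) - x) := by module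
  simp only [this]
  rw [norm_smul, Real.norm_of_nonneg ht0, ht, div_mul_cancel₀ _ hd0.ne']

end Uniform

/-! ### Kullback-Leibler divergence and expected log-density -/

/-- The log-likelihood ratio with respect to a measure given by a density. -/
theorem llr_withDensity_ae_eq {α : Type*} [MeasurableSpace α] {μ ν : Measure α} [SigmaFinite μ]
    [SigmaFinite ν] {f : α → ℝ≥0} (hμν : μ ≪ ν) (hf : Measurable f) (hpos : ∀ᵐ a ∂μ, 0 < f a) :
    μ ≪ ν.withDensity (fun a => (f a : ℝ≥0∞)) ∧
    llr μ (ν.withDensity fun a => (f a : ℝ≥0∞)) =ᵐ[μ] fun a => llr μ ν a - Real.log (f a) := by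
  have hfm : Measurable fun a => (f a : ℝ≥0∞) := hf.coe_nnreal_ennreal
  have hr : Measurable (μ.rnDeriv ν) := Measure.measurable_rnDeriv μ ν
  -- `ν`-almost everywhere, `f` can vanish only where the density of `μ` does, so division by `f` is
  -- harmless.
  have hsupp : ∀ᵐ a ∂ν, μ.rnDeriv ν a ≠ 0 → 0 < f a := by
    rw [← ae_withDensity_iff hr, Measure.withDensity_rnDeriv_eq μ ν hμν]
    exact hpos
  have hkey : μ = (ν.withDensity fun a => (f a : ℝ≥0∞)).withDensity
      fun a => (f a : ℝ≥0∞)⁻¹ * μ.rnDeriv ν a := by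
    refine Eq.trans ?_ (withDensity_mul ν hfm (hfm.inv.mul hr))
    conv_lhs => rw [← Measure.withDensity_rnDeriv_eq μ ν hμν]
    refine withDensity_congr_ae ?_
    filter_upwards [hsupp] with a ha
    by_cases h0 : μ.rnDeriv ν a = 0
    · simp [h0]
    · have := ha h0
      simp only [Pi.mul_apply]
      rw [← mul_assoc, ENNReal.mul_inv_cancel (by simpa using this.ne') ENNReal.coe_ne_top, one_mul]
  have hac : μ ≪ ν.withDensity (fun a => (f a : ℝ≥0∞)) := by
    conv_lhs => rw [hkey]
    exact withDensity_absolutelyContinuous _ _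
  refine ⟨hac, ?_⟩
  have hd : μ.rnDeriv (ν.withDensity fun a => (f a : ℝ≥0∞)) =ᵐ[ν.withDensity fun a => (f a : ℝ≥0∞)]
      fun a => (f a : ℝ≥0∞)⁻¹ * μ.rnDeriv ν a := by
    conv_lhs => rw [hkey]
    exact Measure.rnDeriv_withDensity _ (hfm.inv.mul hr)
  filter_upwards [hac.ae_le hd, hpos, Measure.rnDeriv_pos hμν,
    hμν.ae_le (Measure.rnDeriv_lt_top μ ν)] with a h1 h2 h3 h4
  simp only [llr_def]
  rw [h1, ENNReal.toReal_mul, Real.log_mul, ENNReal.toReal_inv, Real.log_inv, ENNReal.coe_toReal]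
  · ring
  · simpa using h2.ne'
  · exact (ENNReal.toReal_pos h3.ne' h4.ne).ne'

/-- Among measures given by densities with finite expected logarithm, a smaller Kullback-Leibler
divergence means a larger expected logarithm of the density. -/
theorem integral_log_lt_of_klDiv_lt {α : Type*} [MeasurableSpace α] {μ ν : Measure α}
    [IsProbabilityMeasure μ] [SigmaFinite ν] {f₁ f₂ : α → ℝ≥0}
    (hf₁ : Measurable f₁) (hf₂ : Measurable f₂)
    [IsProbabilityMeasure (ν.withDensity fun a => (f₁ a : ℝ≥0∞))]
    [IsProbabilityMeasure (ν.withDensity fun a => (f₂ a : ℝ≥0∞))]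
    (h₁ : FiniteExpectedLog μ f₁) (h₂ : FiniteExpectedLog μ f₂)
    (h : InformationTheory.klDiv μ (ν.withDensity fun a => (f₁ a : ℝ≥0∞)) <
      InformationTheory.klDiv μ (ν.withDensity fun a => (f₂ a : ℝ≥0∞))) :
    ∫ a, Real.log (f₂ a) ∂μ < ∫ a, Real.log (f₁ a) ∂μ := by
  -- Being strictly below another divergence, the first one is finite.
  obtain ⟨hac, h_int⟩ := InformationTheory.klDiv_ne_top_iff.1 h.ne_top
  have hμν : μ ≪ ν := hac.trans (withDensity_absolutelyContinuous _ _)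
  obtain ⟨hac₁, he₁⟩ := llr_withDensity_ae_eq hμν hf₁ h₁.1
  obtain ⟨hac₂, he₂⟩ := llr_withDensity_ae_eq hμν hf₂ h₂.1
  have hllr : Integrable (llr μ ν) μ := by
    refine (((integrable_congr he₁).1 h_int).add h₁.2).congr (ae_of_all _ fun a => ?_)
    simp
  have h_int₂ : Integrable (llr μ (ν.withDensity fun a => (f₂ a : ℝ≥0∞))) μ :=
    (integrable_congr he₂).2 (hllr.sub h₂.2)
  -- Both divergences are finite, so they can be compared as reals, where the common term `∫ llr μ
  -- ν` cancels.
  have ht := (ENNReal.toReal_lt_toReal h.ne_top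
    (InformationTheory.klDiv_ne_top hac₂ h_int₂)).2 h
  rw [InformationTheory.toReal_klDiv_of_measure_eq hac₁ (by simp),
    InformationTheory.toReal_klDiv_of_measure_eq hac₂ (by simp),
    integral_congr_ae he₁, integral_congr_ae he₂, integral_sub hllr h₁.2,
    integral_sub hllr h₂.2] at ht
  linarith

/-- The joint law of the model has density `p` with respect to a product measure. -/
theorem IsCondDensity.compProd_eq {𝒳 𝒴 : Type*} [MeasurableSpace 𝒳] [MeasurableSpace 𝒴]
    {ν : Measure 𝒴} [SFinite ν] {Q : Kernel 𝒳 𝒴} [IsSFiniteKernel Q] {p : 𝒳 → 𝒴 → ℝ≥0}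
    (hp : IsCondDensity ν Q p) (hpm : Measurable fun xy : 𝒳 × 𝒴 => p xy.1 xy.2)
    (m : Measure 𝒳) [SFinite m] :
    m ⊗ₘ Q = (m.prod ν).withDensity fun xy => (p xy.1 xy.2 : ℝ≥0∞) := by
  ext s hs
  rw [Measure.compProd_apply hs, withDensity_apply _ hs, ← lintegral_indicator hs,
    lintegral_prod _ (hpm.coe_nnreal_ennreal.indicator hs).aemeasurable]
  refine lintegral_congr fun x => ?_
  rw [hp x, withDensity_apply _ (measurable_prodMk_left hs),
    ← lintegral_indicator (measurable_prodMk_left hs)]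
  rfl

/-! ### Posterior mass -/

theorem bayesPosterior_le_one {T : Type*} [MeasurableSpace T] (prior : Measure T)
    (L : T → ℝ≥0∞) (s : Set T) : bayesPosterior prior L s ≤ 1 := by
  refine (measure_mono (Set.subset_univ s)).trans ?_
  rw [bayesPosterior, Measure.smul_apply, withDensity_apply _ MeasurableSet.univ,
    Measure.restrict_univ, smul_eq_mul]
  exact ENNReal.inv_mul_le_one _

/-- If the likelihood is at most `u` off the set `B`, and at least `l` on the set `V`, then the
posterior mass of `B` is bounded below. -/
theorem one_sub_le_bayesPosterior {T : Type*} [MeasurableSpace T] {prior : Measure T}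
    [IsProbabilityMeasure prior] {L : T → ℝ≥0∞} {B V : Set T} (hB : MeasurableSet B)
    (hV : MeasurableSet V) (hV0 : prior V ≠ 0) {C u l : ℝ≥0∞} (hC : C ≠ ∞) (hl0 : l ≠ 0)
    (hl : l ≠ ∞) (hLC : ∀ θ ∈ B, L θ ≤ C) (hu : u ≠ ∞) (hLu : ∀ θ ∉ B, L θ ≤ u)
    (hLl : ∀ θ ∈ V, l ≤ L θ) :
    1 - u * (l⁻¹ * (prior V)⁻¹) ≤ bayesPosterior prior L B := by
  set Z := ∫⁻ θ, L θ ∂prior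
  have hZl : l * prior V ≤ Z := by
    rw [← setLIntegral_const]
    exact (setLIntegral_mono' hV hLl).trans (setLIntegral_le_lintegral _ _)
  -- The posterior has total mass one only if the evidence is neither zero nor infinite; the bound
  -- `C` serves only for finiteness.
  have hZ0 : Z ≠ 0 := fun h => mul_ne_zero hl0 hV0 (le_zero_iff.1 (h ▸ hZl))
  have hZtop : Z ≠ ∞ := by
    refine ne_top_of_le_ne_top (ENNReal.add_ne_top.2 ⟨hC, hu⟩) ?_
    calc Z ≤ ∫⁻ _, C + u ∂prior := by
          refine lintegral_mono fun θ => ?_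
          by_cases h : θ ∈ B
          · exact (hLC θ h).trans le_self_add
          · exact (hLu θ h).trans le_add_self
      _ = C + u := by simp
  have huniv : bayesPosterior prior L B + bayesPosterior prior L Bᶜ = 1 := by
    rw [measure_add_measure_compl hB, bayesPosterior, Measure.smul_apply,
      withDensity_apply _ MeasurableSet.univ, Measure.restrict_univ, smul_eq_mul,
      ENNReal.inv_mul_cancel hZ0 hZtop]
  have hcompl : bayesPosterior prior L Bᶜ ≤ u * (l⁻¹ * (prior V)⁻¹) := by
    rw [bayesPosterior, Measure.smul_apply, withDensity_apply _ hB.compl, smul_eq_mul, mul_comm,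
      ← ENNReal.mul_inv (Or.inl hl0) (Or.inl hl)]
    gcongr
    calc ∫⁻ θ in Bᶜ, L θ ∂prior ≤ ∫⁻ _ in Bᶜ, u ∂prior := setLIntegral_mono' hB.compl hLu
      _ = u * prior Bᶜ := setLIntegral_const _ _
      _ ≤ u := mul_le_of_le_one_right' prob_le_one
  rw [tsub_le_iff_right, ← huniv]
  gcongr

/-- The posterior for log-concave likelihoods with exponential rate `ℓ` concentrates at the strict
maximizer of `ℓ`. -/
theorem stronglyConsistentAt_of_logConcaveOn {E : Type*} [NormedAddCommGroup E] [NormedSpace ℝ E]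
    [FiniteDimensional ℝ E] [MeasurableSpace E] [BorelSpace E] {Θ : Set E} {Ω : Type*}
    [MeasurableSpace Ω] {μ : Measure Ω} {L : ℕ → Ω → Θ → ℝ≥0∞} {ℓ : E → ℝ} (hΘ : Convex ℝ Θ)
    (hL : ∀ᵐ ω ∂μ, ∀ n, LogConcaveOn Θ (L n ω)) (hℓ : ContinuousOn ℓ (interior Θ))
    (hlow : ∀ (θ : Θ) (c : ℝ), c < ℓ θ → ∀ᵐ ω ∂μ, ∀ᶠ n in atTop, expRate n c < L n ω θ)
    (hupp : ∀ (θ : Θ) (c : ℝ), ℓ θ < c → ∀ᵐ ω ∂μ, ∀ᶠ n in atTop, L n ω θ < expRate n c)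
    {θs : Θ} (h_int : (θs : E) ∈ interior Θ) (hmax : ∀ θ ∈ Θ, θ ≠ θs → ℓ θ < ℓ θs)
    (prior : Measure Θ) [IsProbabilityMeasure prior]
    (hprior : ∀ U : Set Θ, IsOpen U → θs ∈ U → 0 < prior U) :
    StronglyConsistentAt μ (fun n ω => bayesPosterior prior (L n ω)) θs := by
  have hmeas : ∀ r : ℝ, MeasurableSet {θ : Θ | (θ : E) ∈ Metric.ball (θs : E) r} := fun r =>
    measurable_subtype_coe Metric.isOpen_ball.measurableSet
  -- Any finite bound near `θs` would do in place of `ℓ θs + 1`.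
  obtain ⟨r₀, hr₀, hC⟩ := exists_ball_le_expRate hΘ hL hℓ hlow hupp h_int
    (show ℓ θs < ℓ θs + 1 by linarith)
  obtain ⟨r₁, hr₁, hr₁Θ⟩ := Metric.mem_nhds_iff.1 (isOpen_interior.mem_nhds h_int)
  set r := min r₀ r₁
  have hr : 0 < r := lt_min hr₀ hr₁
  have hball : ∀ ε, 0 < ε → ε < r → ∀ᵐ ω ∂μ, Tendsto (fun n =>
      bayesPosterior prior (L n ω) {θ : Θ | (θ : E) ∈ Metric.ball (θs : E) ε}) atTop (𝓝 1) := by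
    intro ε hε hεr
    obtain ⟨c, hc, hout⟩ := exists_le_expRate_compl_ball hΘ hL hℓ hlow hupp hε
      ((Metric.closedBall_subset_ball (hεr.trans_le (min_le_right _ _))).trans hr₁Θ) hmax
    obtain ⟨c', hcc', hc'⟩ := exists_between hc
    obtain ⟨ρ, hρ, -, hin⟩ := exists_ball_expRate_lt hΘ hL hℓ hlow h_int hc'
    set V : Set Θ := {θ : Θ | (θ : E) ∈ Metric.ball (θs : E) ρ}
    have hV0 : prior V ≠ 0 :=
      (hprior V (Metric.isOpen_ball.preimage continuous_subtype_val)
        (Metric.mem_ball_self hρ)).ne'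
    filter_upwards [hC, hout, hin] with ω h1 h2 h3
    have hlim : Tendsto (fun n : ℕ => 1 - expRate n (c - c') * (prior V)⁻¹) atTop (𝓝 1) := by
      have := ENNReal.Tendsto.mul_const (tendsto_expRate_zero (sub_neg.2 hcc'))
        (b := (prior V)⁻¹) (Or.inr (ENNReal.inv_ne_top.2 hV0))
      have := ENNReal.Tendsto.sub (tendsto_const_nhds (x := (1 : ℝ≥0∞))) this
        (Or.inl ENNReal.one_ne_top)
      simpa using this
    refine tendsto_of_tendsto_of_tendsto_of_le_of_le' hlim tendsto_const_nhds ?_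
      (Eventually.of_forall fun n => bayesPosterior_le_one _ _ _)
    filter_upwards [h1, h2, h3] with n h1 h2 h3
    have hb := one_sub_le_bayesPosterior (hmeas ε) (hmeas ρ) hV0 (expRate_ne_top n (ℓ θs + 1))
      (expRate_pos n c').ne' (expRate_ne_top n c')
      (fun θ hθ => h1 θ (Metric.ball_subset_ball (hεr.le.trans (min_le_left _ _)) hθ))
      (expRate_ne_top n c) h2 fun θ hθ => (h3 θ hθ).le
    refine le_trans (le_of_eq ?_) hb
    rw [← mul_assoc, ← ENNReal.rpow_neg_one (expRate n c'), expRate_rpow, expRate_mul]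
    congr 3; ring
  -- Countably many radii give one null set valid for all neighbourhoods.
  have hall : ∀ᵐ ω ∂μ, ∀ k : ℕ, Tendsto (fun n => bayesPosterior prior (L n ω)
      {θ : Θ | (θ : E) ∈ Metric.ball (θs : E) (r / ((k : ℝ) + 2))}) atTop (𝓝 1) :=
    ae_all_iff.2 fun k => hball _ (by positivity)
      (div_lt_self hr (by have : (0 : ℝ) ≤ k := k.cast_nonneg; linarith))
  filter_upwards [hall] with ω h U hU
  obtain ⟨ε, hε, hεU⟩ := Metric.mem_nhds_iff.1 hU
  obtain ⟨k, hk⟩ := exists_nat_gt (r / ε)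
  refine tendsto_of_tendsto_of_tendsto_of_le_of_le (h k) tendsto_const_nhds
    (fun n => measure_mono fun θ hθ => hεU ?_) fun n => bayesPosterior_le_one _ _ _
  refine (show dist (θ : E) (θs : E) < _ from hθ).trans ?_
  rw [div_lt_iff₀ (by positivity)]
  rw [div_lt_iff₀ hε] at hk
  nlinarith

/-! ### Law of large numbers and concavity of the rate -/

/-- By the strong law of large numbers, the average log-likelihood converges to its expectation. -/
theorem ae_tendsto_log_prod {Ω α : Type*} [MeasurableSpace Ω] [MeasurableSpace α] {μ : Measure Ω}
    {P : Measure α} {D : ℕ → Ω → α} (hlaw : ∀ i, HasLaw (D i) P μ) (hindep : iIndepFun D μ)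
    {f : α → ℝ≥0} (hf : Measurable f) (hfin : FiniteExpectedLog P f) :
    ∀ᵐ ω ∂μ, (∀ i, 0 < f (D i ω)) ∧
      Tendsto (fun n : ℕ => (∑ i ∈ Finset.range n, Real.log (f (D i ω))) / n) atTop
        (𝓝 (∫ a, Real.log (f a) ∂P)) := by
  have hg : Measurable fun a => Real.log (f a) := Real.measurable_log.comp hf.coe_nnreal_real
  have hpos : ∀ᵐ ω ∂μ, ∀ i, 0 < f (D i ω) := ae_all_iff.2 fun i =>
    ae_of_ae_map (hlaw i).aemeasurable ((hlaw i).map_eq.symm ▸ hfin.1)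
  have hident : ∀ i, IdentDistrib (fun ω => Real.log (f (D i ω)))
      (fun ω => Real.log (f (D 0 ω))) μ μ := fun i => ((hlaw i).identDistrib (hlaw 0)).comp hg
  have h_int : Integrable (fun ω => Real.log (f (D 0 ω))) μ := by
    have h := hfin.2
    rw [← (hlaw 0).map_eq] at h
    exact h.comp_aemeasurable (hlaw 0).aemeasurable
  have hslln := strong_law_ae_real (fun i ω => Real.log (f (D i ω))) h_int
    (fun i j hij => (hindep.indepFun hij).comp hg hg) hident
  have hexp : ∫ ω, Real.log (f (D 0 ω)) ∂μ = ∫ a, Real.log (f a) ∂P :=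
    (hlaw 0).integral_comp hg.aestronglyMeasurable
  rw [hexp] at hslln
  exact hpos.and hslln

theorem prod_eq_ofReal_exp_sum_log {ι : Type*} (s : Finset ι) {f : ι → ℝ≥0}
    (hf : ∀ i ∈ s, 0 < f i) :
    ∏ i ∈ s, (f i : ℝ≥0∞) = ENNReal.ofReal (Real.exp (∑ i ∈ s, Real.log (f i))) := by
  rw [Real.exp_sum, ENNReal.ofReal_prod_of_nonneg fun i _ => (Real.exp_pos _).le]
  refine Finset.prod_congr rfl fun i hi => ?_
  rw [Real.exp_log (NNReal.coe_pos.2 (hf i hi)), ENNReal.ofReal_coe_nnreal]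

/-- The expectation of concave log-densities is concave. -/
theorem concaveOn_integral_log {E α : Type*} [AddCommGroup E] [Module ℝ E] [MeasurableSpace α]
    {P : Measure α} {Θ : Set E} (hΘ : Convex ℝ Θ) {f : Θ → α → ℝ≥0}
    (hfin : ∀ θ, FiniteExpectedLog P (f θ)) (hconc : ∀ᵐ a ∂P, ConcaveLog Θ fun θ => f θ a)
    {ℓ : E → ℝ} (hℓ : ∀ θ : Θ, ℓ θ = ∫ a, Real.log (f θ a) ∂P) : ConcaveOn ℝ Θ ℓ := by
  refine ⟨hΘ, fun x hx y hy a b ha hb hab => ?_⟩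
  have hz := hΘ hx hy ha hb hab
  have hx' : Integrable (fun t => a • Real.log (f ⟨x, hx⟩ t)) P := (hfin _).2.smul a
  have hy' : Integrable (fun t => b • Real.log (f ⟨y, hy⟩ t)) P := (hfin _).2.smul b
  rw [hℓ ⟨x, hx⟩, hℓ ⟨y, hy⟩, hℓ ⟨_, hz⟩, ← integral_smul, ← integral_smul,
    ← integral_add hx' hy']
  refine integral_mono_ae (hx'.add hy') (hfin _).2 ?_
  filter_upwards [hconc, (hfin ⟨x, hx⟩).1, (hfin ⟨y, hy⟩).1, (hfin ⟨_, hz⟩).1] with t h h1 h2 h3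
  have key := h.2 ⟨x, hx⟩ ⟨y, hy⟩ ⟨_, hz⟩ a b ha hb hab rfl
  have hlog : ∀ u : ℝ≥0, 0 < u → ENNReal.log (u : ℝ≥0∞) = ((Real.log u : ℝ) : EReal) :=
    fun u hu => by
      rw [ENNReal.log_pos_real (by simpa using hu.ne') ENNReal.coe_ne_top, ENNReal.coe_toReal]
  rw [hlog _ h1, hlog _ h2, hlog _ h3] at key
  exact_mod_cast key

/-! ### The consistency theorem -/

theorem mainTheorem2 {q d : ℕ}
    -- covariate space, response space, parameter set
    (𝒳 : Set (EuclideanSpace ℝ (Fin q))) (𝒴 : Set ℝ) (Θ : Set (EuclideanSpace ℝ (Fin d)))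
    -- the latent model `P_{Z | θ, X}`: continuous distributions on `ℝ`
    (PZ : Θ → Kernel 𝒳 ℝ) [∀ θ, IsMarkovKernel (PZ θ)] (hPZ : ∀ θ x z, PZ θ x {z} = 0)
    -- the fixed transformation and the induced conditional law `P_{Y | g, θ, X}`
    (g : 𝒴 → ℝ) (hg : Monotone g)
    (Q : Θ → Kernel 𝒳 𝒴) [∀ θ, IsMarkovKernel (Q θ)] (hQ : ∀ θ, InducedBy g (PZ θ) (Q θ))
    -- the likelihood `p θ x y = p(y | g, θ, x)`
    (ν : Measure 𝒴) [SigmaFinite ν] (p : Θ → 𝒳 → 𝒴 → ℝ≥0)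
    (hp_meas : Measurable fun t : Θ × 𝒳 × 𝒴 => p t.1 t.2.1 t.2.2)
    (hp : ∀ θ, IsCondDensity ν (Q θ) (p θ))
    -- the prior
    (prior : Measure Θ) [IsProbabilityMeasure prior]
    -- the data: independent draws from an arbitrary data-generating process `P₀`
    (P₀ : Measure (𝒳 × 𝒴)) [IsProbabilityMeasure P₀]
    {Ω : Type*} [MeasurableSpace Ω] (μ : Measure Ω) [IsProbabilityMeasure μ]
    (X : ℕ → Ω → 𝒳) (Y : ℕ → Ω → 𝒴)
    (hlaw : ∀ i, HasLaw (fun ω => (X i ω, Y i ω)) P₀ μ)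
    (hindep : iIndepFun (fun i ω => (X i ω, Y i ω)) μ)
    -- `θs` is the unique minimizer over `Θ` of the KL divergence and is interior
    (θs : Θ) (hθs_int : (θs : EuclideanSpace ℝ (Fin d)) ∈ interior Θ)
    (hθs_min : ∀ θ : Θ, θ ≠ θs →
      InformationTheory.klDiv P₀ (P₀.fst ⊗ₘ Q θs) < InformationTheory.klDiv P₀ (P₀.fst ⊗ₘ Q θ))
    -- finite expected log-likelihood
    (hfin : ∀ θ, FiniteExpectedLog P₀ fun xy => p θ xy.1 xy.2)
    -- concave log-likelihood, almost surely
    (hconc : ∀ᵐ xy ∂P₀, ConcaveLog Θ fun θ => p θ xy.1 xy.2)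
    -- the prior charges every neighbourhood of the minimizer
    (hprior : ∀ U : Set Θ, IsOpen U → θs ∈ U → 0 < prior U) :
    StronglyConsistentAt μ
      (fun n ω => bayesPosterior prior (likelihood p (fun i => X i ω) (fun i => Y i ω) n)) θs := by
  have hΘ : Convex ℝ Θ := by
    obtain ⟨xy, h⟩ := hconc.exists
    exact h.1
  have hpm : ∀ θ, Measurable fun xy : 𝒳 × 𝒴 => p θ xy.1 xy.2 := fun θ =>
    hp_meas.comp (measurable_const.prodMk measurable_id)
  classical
  -- The value off `Θ` is arbitrary; a function on the whole space lets concavity yield continuity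
  -- on `interior Θ`.
  let ℓ : EuclideanSpace ℝ (Fin d) → ℝ := fun θ =>
    if h : θ ∈ Θ then ∫ xy, Real.log (p ⟨θ, h⟩ xy.1 xy.2) ∂P₀ else 0
  have hℓ : ∀ θ : Θ, ℓ θ = ∫ xy, Real.log (p θ xy.1 xy.2) ∂P₀ := fun θ => dif_pos θ.2
  have hslln : ∀ θ : Θ, ∀ᵐ ω ∂μ, (∀ i, 0 < p θ (X i ω) (Y i ω)) ∧
      Tendsto (fun n : ℕ => (∑ i ∈ Finset.range n, Real.log (p θ (X i ω) (Y i ω))) / n) atTop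
        (𝓝 (ℓ θ)) := fun θ => by
    rw [hℓ θ]
    exact ae_tendsto_log_prod hlaw hindep (hpm θ) (hfin θ)
  refine stronglyConsistentAt_of_logConcaveOn hΘ ?_
    (concaveOn_integral_log hΘ hfin hconc hℓ).continuousOn_interior ?_ ?_ hθs_int ?_ prior hprior
  · have : ∀ᵐ ω ∂μ, ∀ i, ConcaveLog Θ fun θ => p θ (X i ω) (Y i ω) := ae_all_iff.2 fun i =>
      ae_of_ae_map (hlaw i).aemeasurable ((hlaw i).map_eq.symm ▸ hconc)
    filter_upwards [this] with ω h n
    exact LogConcaveOn.prod _ fun i _ => (h i).logConcaveOn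
  · intro θ c hc
    filter_upwards [hslln θ] with ω ⟨hpos, hlim⟩
    filter_upwards [hlim.eventually_const_lt hc, eventually_gt_atTop 0] with n hn hn0
    rw [likelihood, prod_eq_ofReal_exp_sum_log _ fun i _ => hpos i, expRate,
      ENNReal.ofReal_lt_ofReal_iff (Real.exp_pos _), Real.exp_lt_exp]
    rwa [lt_div_iff₀' (Nat.cast_pos.2 hn0)] at hn
  · intro θ c hc
    filter_upwards [hslln θ] with ω ⟨hpos, hlim⟩
    filter_upwards [hlim.eventually_lt_const hc, eventually_gt_atTop 0] with n hn hn0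
    rw [likelihood, prod_eq_ofReal_exp_sum_log _ fun i _ => hpos i, expRate,
      ENNReal.ofReal_lt_ofReal_iff (Real.exp_pos _), Real.exp_lt_exp]
    rwa [div_lt_iff₀' (Nat.cast_pos.2 hn0)] at hn
  · intro θ hθ hne
    rw [hℓ θs, hℓ ⟨θ, hθ⟩]
    -- All model laws share the dominating measure `P₀.fst.prod ν`, so their divergences from `P₀`
    -- are comparable through densities.
    have heq : ∀ θ, P₀.fst ⊗ₘ Q θ =
        (P₀.fst.prod ν).withDensity fun xy => (p θ xy.1 xy.2 : ℝ≥0∞) := fun θ =>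
      (hp θ).compProd_eq (hpm θ) _
    have hprob : ∀ θ, IsProbabilityMeasure
        ((P₀.fst.prod ν).withDensity fun xy => (p θ xy.1 xy.2 : ℝ≥0∞)) := fun θ =>
      heq θ ▸ inferInstance
    have := hprob θs
    have := hprob ⟨θ, hθ⟩
    have hkl := hθs_min ⟨θ, hθ⟩ fun h => hne (congrArg Subtype.val h)
    rw [heq, heq] at hkl
    exact integral_log_lt_of_klDiv_lt (hpm _) (hpm _) (hfin _) (hfin _) hkl
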